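/- **Definitions.** Let $S^1=\{z\in\mathbb C:|z|=1\}$. For $u\ne v$ in $S^1$ let $(u,v)$ be the set of points strictly between $u$ and $v$ in the counterclockwise direction (a *nondegenerate open interval*); its dual is $(u,v)^*=(v,u)$. For such an interval $I$ put $\ell(I)=\{I,I^*\}$, and say that $\ell(I)$ *lies on* $J$ if $I\subseteq J$ or $I^*\subseteq J$. A *lamination system* is a nonempty family $\mathcal L$ of nondegenerate open intervals of $S^1$ such that (1) $I\in\mathcal L$ implies $I^*\in\mathcal L$; (2) for all $I,J\in\mathcal L$, $\ell(I)$ lies on $J$ or on $J^*$; (3) if $I_1\subseteq I_2\subseteq\cdots$ are in $\mathcal L$ and $\bigcup_n I_n$ is a nondegenerate open interval, then $\bigcup_n I_n\in\mathcal L$. A *leaf* of $\mathcal L$ is a set $\ell(I)$ with $I\in\mathcal L$. A *gap* of $\mathcal L$ is a set $\mathcal G\subseteq\mathcal L$ of pairwise disjoint intervals such that for every $I\in\mathcal L$ the leaf $\ell(I)$ lies on some $J\in\mathcal G$; a *non-leaf gap* is a gap that is not a leaf. $\mathcal L$ is *very full* if $S^1\setminus\bigcup_{I\in\mathcal G}I$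 is finite for every gap $\mathcal G$. $\mathcal L$ is *totally disconnected* if for all disjoint $I,J\in\mathcal L$ such that $\{I,J\}$ is not a leaf there are a non-leaf gap $\mathcal G$ and $K,K'\in\mathcal G$ (possibly equal) with $I\subseteq K$ and $J\subseteq K'$. A sequence $(\ell_n)$ of leaves *converges* to a nondegenerate open interval $J$ if there are $I_n\in\mathcal L$ with $\ell_n=\ell(I_n)$ and $J\subseteq\liminf I_n\subseteq\limsup I_n\subseteq\overline J$; it converges to a leaf $\ell$ if it converges to some $I\in\ell$. An interval $I\in\mathcal L$ is *isolated* if there is no sequence of leaves $\ell_n$ with $I\notin\ell_n$ and $\ell_n$ lying on $I$ for all $n$, and with $\ell_n\to I$. A leaf is *isolated* if both of its elements are isolated. Let $G$ be a subgroup of $\mathrm{Homeo}^+(S^1)$, the group of orientation-preserving homeomorphisms of $S^1$. The pair $(\mathcal L,G)$ is a *tight pair* if $\mathcal L$ is a lamination system with $g(I)\in\mathcal L$ for all $g\in G$, $I\in\mathcal L$; $\mathcal L$ is very full and totally disconnected; no leaf of $\mathcal L$ is isolated; $G$ acts minimally on $\mathcal L$, that is, for any two leaves $\ell,\ell'$ there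 is a sequence $(g_n)$ in $G$ with $g_n(\ell')\to\ell$; and the non-leaf gaps of $\mathcal L$ form finitely many $G$-orbits. **Corollary.** Let $(\mathcal L,G)$ be a tight pair such that $G$ has no global fixed point on $S^1$ (no $x\in S^1$ with $g(x)=x$ for all $g\in G$). Then $G$ contains a non-abelian free subgroup. -/

import Mathlib

open Set Filter

/-! ### The circle, its circular order and its open intervals -/

/-- The stereographic coordinate `Im z / (Re z - 1)` of a point `z ≠ 1` of the unit circle; it
increases from `-∞` to `∞` as `z` runs counterclockwise around the circle from `1` to `1`. -/
noncomputable def stereoCoord (z : Circle) : ℝ :=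
  (z : ℂ).im / ((z : ℂ).re - 1)

/-- `(x, y, z)` is a positively oriented triple of pairwise distinct points of the circle. -/
def PosOriented (x y z : Circle) : Prop :=
  x ≠ y ∧ y ≠ z ∧ x ≠ z ∧ stereoCoord (x⁻¹ * y) < stereoCoord (x⁻¹ * z)

/-- A nondegenerate open interval of the circle, given by its initial endpoint `u` and its
terminal endpoint `v ≠ u`. -/
@[ext]
structure Arc where
  u : Circle
  v : Circle
  ne : u ≠ v

namespace Arc

/-- The underlying set of the nondegenerate open interval `(u, v)`. -/
def toSet (I : Arc) : Set Circle :=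
  {p | PosOriented I.u p I.v}

/-- The dual interval `(v, u)` of `(u, v)`. -/
def dual (I : Arc) : Arc :=
  ⟨I.v, I.u, I.ne.symm⟩

end Arc

theorem stereoCoord_lt_iff {y z : Circle} (hy : y ≠ 1) (hz : z ≠ 1) :
    stereoCoord y < stereoCoord z ↔
      0 < ((y : ℂ).re - 1) * (z : ℂ).im - (y : ℂ).im * ((z : ℂ).re - 1) := by
  have key : ∀ w : Circle, w ≠ 1 → (w : ℂ).re - 1 < 0 := by
    intro w hw
    have h1 : (w : ℂ).re * (w : ℂ).re + (w : ℂ).im * (w : ℂ).im = 1 := by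
      have := Circle.normSq_coe w
      rwa [Complex.normSq_apply] at this
    by_contra hcon
    apply hw
    have hre : (w : ℂ).re = 1 := by nlinarith [mul_self_nonneg (w : ℂ).im]
    have him : (w : ℂ).im = 0 := by
      rw [hre] at h1
      nlinarith
    apply Circle.ext
    apply Complex.ext <;> simp [hre, him]
  have h1 := key y hy
  have h2 := key z hz
  unfold stereoCoord
  rw [← neg_div_neg_eq, ← neg_div_neg_eq (z : ℂ).im,
    div_lt_div_iff₀ (by linarith) (by linarith)]
  constructor <;> intro h <;> nlinarith

/-- A triple is positively oriented if and only if the triangle that it spans has positive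
signed area. -/
theorem posOriented_iff (x y z : Circle) :
    PosOriented x y z ↔
      0 < ((y : ℂ).re - (x : ℂ).re) * ((z : ℂ).im - (x : ℂ).im)
        - ((y : ℂ).im - (x : ℂ).im) * ((z : ℂ).re - (x : ℂ).re) := by
  have hx : (x : ℂ).re * (x : ℂ).re + (x : ℂ).im * (x : ℂ).im = 1 := by
    have := Circle.normSq_coe x
    rwa [Complex.normSq_apply] at this
  have aux : ∀ w : Circle, x ≠ w → x⁻¹ * w ≠ 1 := by
    intro w hw h
    exact hw (inv_mul_eq_one.mp h)
  have hre : ∀ w : Circle, ((x⁻¹ * w : Circle) : ℂ).re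
      = (x : ℂ).re * (w : ℂ).re + (x : ℂ).im * (w : ℂ).im := by
    intro w
    rw [Circle.coe_mul, Circle.coe_inv_eq_conj]
    simp [Complex.mul_re]
  have him : ∀ w : Circle, ((x⁻¹ * w : Circle) : ℂ).im
      = (x : ℂ).re * (w : ℂ).im - (x : ℂ).im * (w : ℂ).re := by
    intro w
    rw [Circle.coe_mul, Circle.coe_inv_eq_conj]
    simp [Complex.mul_im]
    ring
  have harea : (((x⁻¹ * y : Circle) : ℂ).re - 1) * ((x⁻¹ * z : Circle) : ℂ).im
      - ((x⁻¹ * y : Circle) : ℂ).im * (((x⁻¹ * z : Circle) : ℂ).re - 1)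
      = ((y : ℂ).re - (x : ℂ).re) * ((z : ℂ).im - (x : ℂ).im)
        - ((y : ℂ).im - (x : ℂ).im) * ((z : ℂ).re - (x : ℂ).re) := by
    rw [hre, hre, him, him]
    linear_combination ((y : ℂ).re * (z : ℂ).im - (y : ℂ).im * (z : ℂ).re) * hx
  constructor
  · rintro ⟨h1, _, h3, h4⟩
    rw [stereoCoord_lt_iff (aux y h1) (aux z h3), harea] at h4
    exact h4
  · intro h
    have h1 : x ≠ y := by
      rintro rfl
      simp at h
    have h3 : x ≠ z := by
      rintro rfl
      simp at h
    refine ⟨h1, ?_, h3, ?_⟩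
    · rintro rfl
      have : ∀ a b : ℝ, a * b - b * a = 0 := fun a b => by ring
      rw [this] at h
      exact lt_irrefl _ h
    · rw [stereoCoord_lt_iff (aux y h1) (aux z h3), harea]
      exact h

theorem PosOriented.rotate {x y z : Circle} (h : PosOriented x y z) : PosOriented y z x := by
  rw [posOriented_iff] at h ⊢
  linarith

theorem PosOriented.trans {x y z w : Circle} (h : PosOriented x y z) (h' : PosOriented x z w) :
    PosOriented x y w := by
  refine ⟨h.1, ?_, h'.2.2.1, h.2.2.2.trans h'.2.2.2⟩
  rintro rfl
  exact lt_asymm h.2.2.2 h'.2.2.2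

theorem PosOriented.asymm {x y z : Circle} (h : PosOriented x y z) : ¬ PosOriented x z y :=
  fun h' => lt_asymm h.2.2.2 h'.2.2.2

theorem posOriented_total {x y z : Circle} (hxy : x ≠ y) (hyz : y ≠ z) (hxz : x ≠ z) :
    PosOriented x y z ∨ PosOriented x z y := by
  rcases lt_trichotomy (stereoCoord (x⁻¹ * y)) (stereoCoord (x⁻¹ * z)) with h | h | h
  · exact Or.inl ⟨hxy, hyz, hxz, h⟩
  · exfalso
    have hn : ∀ w : Circle, (w : ℂ).re * (w : ℂ).re + (w : ℂ).im * (w : ℂ).im = 1 := by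
      intro w
      have := Circle.normSq_coe w
      rwa [Complex.normSq_apply] at this
    have e1 : ¬ PosOriented x y z := fun h' => h'.2.2.2.ne h
    have e2 : ¬ PosOriented x z y := fun h' => h'.2.2.2.ne h.symm
    rw [posOriented_iff] at e1 e2
    have hx := hn x
    have hy := hn y
    have hz := hn z
    have ne1 : ∀ {a b : Circle}, a ≠ b →
        0 < ((a : ℂ).re - (b : ℂ).re) ^ 2 + ((a : ℂ).im - (b : ℂ).im) ^ 2 := by
      intro a b hab
      by_contra hcon
      apply hab
      apply Circle.ext
      apply Complex.ext
      · nlinarith [sq_nonneg ((a : ℂ).re - (b : ℂ).re), sq_nonneg ((a : ℂ).im - (b : ℂ).im)]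
      · nlinarith [sq_nonneg ((a : ℂ).re - (b : ℂ).re), sq_nonneg ((a : ℂ).im - (b : ℂ).im)]
    have p1 := ne1 hxy
    have p2 := ne1 hyz
    have p3 := ne1 hxz
    generalize (x : ℂ).re = a at *
    generalize (x : ℂ).im = b at *
    generalize (y : ℂ).re = c at *
    generalize (y : ℂ).im = d at *
    generalize (z : ℂ).re = e at *
    generalize (z : ℂ).im = f at *
    have e0 : (c - a) * (f - b) - (d - b) * (e - a) = 0 := by linarith
    have q1 : ((a - c) ^ 2 + (b - d) ^ 2) * ((a - e) ^ 2 + (b - f) ^ 2)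
        = ((c - a) * (e - a) + (d - b) * (f - b)) * ((a - c) ^ 2 + (b - d) ^ 2) := by
      linear_combination (-2 * (b * (c - a) - a * (d - b))) * e0
        + ((c - a) ^ 2 + (d - b) ^ 2) * (hz - hx)
        - ((c - a) * (e - a) + (d - b) * (f - b)) * (hy - hx)
    have q2 : ((a - e) ^ 2 + (b - f) ^ 2) * ((a - c) ^ 2 + (b - d) ^ 2)
        = ((c - a) * (e - a) + (d - b) * (f - b)) * ((a - e) ^ 2 + (b - f) ^ 2) := by
      linear_combination (2 * (b * (e - a) - a * (f - b))) * e0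
        + ((e - a) ^ 2 + (f - b) ^ 2) * (hy - hx)
        - ((c - a) * (e - a) + (d - b) * (f - b)) * (hz - hx)
    have r1 : (a - e) ^ 2 + (b - f) ^ 2 = (c - a) * (e - a) + (d - b) * (f - b) :=
      mul_left_cancel₀ p1.ne' (by linarith)
    have r2 : (a - c) ^ 2 + (b - d) ^ 2 = (c - a) * (e - a) + (d - b) * (f - b) :=
      mul_left_cancel₀ p3.ne' (by linarith)
    nlinarith
  · exact Or.inr ⟨hxz, hyz.symm, hxy, h⟩

theorem exists_posOriented {x y : Circle} (hxy : x ≠ y) : ∃ p, PosOriented x p y := by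
  have hsurj : ∀ t : ℝ, ∃ w : Circle, w ≠ 1 ∧ stereoCoord w = t := by
    intro t
    have ht : t ^ 2 + 1 ≠ 0 := by positivity
    have hmem : (⟨(t ^ 2 - 1) / (t ^ 2 + 1), -2 * t / (t ^ 2 + 1)⟩ : ℂ)
        ∈ Submonoid.unitSphere ℂ := by
      rw [Submonoid.unitSphere, ← SetLike.mem_coe]
      change _ ∈ Metric.sphere (0 : ℂ) 1
      rw [mem_sphere_zero_iff_norm, ← sq_eq_sq₀ (norm_nonneg _) zero_le_one,
        ← Complex.normSq_eq_norm_sq, Complex.normSq_apply]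
      field_simp
      ring
    refine ⟨⟨_, hmem⟩, ?_, ?_⟩
    · intro h
      have h1 := congrArg (fun z : Circle => (z : ℂ).re) h
      simp only [Circle.coe_one, Complex.one_re] at h1
      rw [div_eq_one_iff_eq ht] at h1
      linarith
    · simp only [stereoCoord]
      have h2 : (t ^ 2 - 1) / (t ^ 2 + 1) - 1 = -2 / (t ^ 2 + 1) := by
        field_simp
        ring
      rw [h2]
      field_simp
  obtain ⟨w, hw, hwt⟩ := hsurj (stereoCoord (x⁻¹ * y) - 1)
  have hlt : stereoCoord (x⁻¹ * (x * w)) < stereoCoord (x⁻¹ * y) := by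
    rw [inv_mul_cancel_left, hwt]
    linarith
  refine ⟨x * w, ?_, ?_, hxy, hlt⟩
  · intro h
    exact hw (mul_eq_left.mp h.symm)
  · intro h
    rw [h] at hlt
    exact lt_irrefl _ hlt

theorem Arc.toSet_injective : Function.Injective Arc.toSet := by
  have mem : ∀ {I J : Arc}, I.toSet = J.toSet → ∀ p, PosOriented I.u p I.v ↔
      PosOriented J.u p J.v := by
    intro I J h p
    exact Set.ext_iff.mp h p
  have dense : ∀ {x y : Circle}, x ≠ y → ∃ p, PosOriented x p y :=
    fun {x y} hxy => exists_posOriented hxy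
  have step : ∀ {I J : Arc}, I.toSet = J.toSet → J.u = I.u := by
    intro I J h
    by_contra hne
    have hm := mem h
    have hJu : ¬ PosOriented I.u J.u I.v := fun h' => ((hm _).1 h').1 rfl
    obtain ⟨x, hx⟩ := dense hne
    obtain ⟨p, hp⟩ := dense I.ne
    have hpJ := (hm p).1 hp
    have hJp : J.u ≠ p := hpJ.1
    by_cases hv : J.u = I.v
    · have h1 : PosOriented J.u x p := by
        have : PosOriented J.u I.u p := by rw [hv]; exact hp.rotate.rotate
        exact hx.trans this
      have h2 := (hm x).2 (h1.trans hpJ)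
      have h3 : PosOriented I.u J.u x := hx.rotate.rotate
      rw [hv] at h3
      exact h2.asymm h3
    · have h0 : PosOriented I.u I.v J.u :=
        (posOriented_total I.ne (Ne.symm hv) (Ne.symm hne)).resolve_right hJu
      have h1 : PosOriented I.u p J.u := hp.trans h0
      have h2 : PosOriented J.u x p := hx.trans h1.rotate.rotate
      have h3 := (hm x).2 (h2.trans hpJ)
      exact (h3.trans h0).asymm hx.rotate.rotate
  have step' : ∀ {I J : Arc}, I.toSet = J.toSet → J.v = I.v := by
    intro I J h
    by_contra hne
    have hu := step h
    have hm := mem h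
    rw [hu] at hm
    have hJ : I.u ≠ J.v := hu ▸ J.ne
    rcases posOriented_total I.ne (Ne.symm hne) hJ with h1 | h1
    · exact ((hm I.v).2 h1).2.1 rfl
    · exact ((hm J.v).1 h1).2.1 rfl
  intro I J h
  exact Arc.ext (step h).symm (step' h).symm

/-! ### Orientation-preserving homeomorphisms of the circle -/

/-- The group `Homeo⁺(S¹)` of orientation-preserving homeomorphisms of the circle. -/
noncomputable def HomeoPlus : Subgroup (Circle ≃ₜ Circle) where
  carrier := {f | ∀ x y z, PosOriented x y z → PosOriented (f x) (f y) (f z)}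
  one_mem' := fun _ _ _ h => h
  mul_mem' := fun {f g} hf hg x y z h => hf _ _ _ (hg x y z h)
  inv_mem' := by
    intro f hf x y z h
    have key : ∀ w, f (f⁻¹ w) = w := fun w => f.apply_symm_apply w
    have inj := (f⁻¹).injective
    rcases posOriented_total (inj.ne h.1) (inj.ne h.2.1) (inj.ne h.2.2.1) with h1 | h1
    · exact h1
    · have h2 := hf _ _ _ h1
      rw [key, key, key] at h2
      exact absurd h2 h.asymm

namespace Arc

/-- The image `g(I)` of a nondegenerate open interval under `g ∈ Homeo⁺(S¹)`. -/
noncomputable def map (g : HomeoPlus) (I : Arc) : Arc :=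
  ⟨g.1 I.u, g.1 I.v, g.1.injective.ne I.ne⟩

theorem toSet_map (g : HomeoPlus) (I : Arc) : (I.map g).toSet = g.1 '' I.toSet := by
  ext p
  constructor
  · intro hp
    refine ⟨g.1⁻¹ p, ?_, g.1.apply_symm_apply p⟩
    have h := (g⁻¹).2 _ _ _ hp
    have e : ∀ w, (g⁻¹).1 (g.1 w) = w := fun w => g.1.symm_apply_apply w
    simp only [map] at h
    rw [e, e] at h
    exact h
  · rintro ⟨q, hq, rfl⟩
    exact g.2 _ _ _ hq

end Arc

/-! ### Lamination systems -/

/-- The leaf `ℓ(I) = {I, I*}`. -/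
def leafOf (I : Arc) : Set Arc :=
  {I, I.dual}

/-- A leaf `ℓ = {I, I*}` lies on `J` if `I ⊆ J` or `I* ⊆ J`. -/
def LiesOn (l : Set Arc) (J : Arc) : Prop :=
  ∃ I ∈ l, I.toSet ⊆ J.toSet

/-- Lamination systems on the circle. -/
structure IsLaminationSystem (L : Set Arc) : Prop where
  nonempty : L.Nonempty
  dual_mem : ∀ I ∈ L, I.dual ∈ L
  unlinked : ∀ I ∈ L, ∀ J ∈ L, LiesOn (leafOf I) J ∨ LiesOn (leafOf I) J.dual
  iUnion_mem : ∀ I : ℕ → Arc, (∀ n, I n ∈ L) → (∀ n, (I n).toSet ⊆ (I (n + 1)).toSet) →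
    ∀ J : Arc, J.toSet = ⋃ n, (I n).toSet → J ∈ L

/-- `l` is a leaf of `L`. -/
def IsLeaf (L : Set Arc) (l : Set Arc) : Prop :=
  ∃ I ∈ L, l = leafOf I

/-- `P` is a gap of `L`. -/
structure IsGap (L : Set Arc) (P : Set Arc) : Prop where
  subset : P ⊆ L
  disjoint : ∀ I ∈ P, ∀ J ∈ P, I ≠ J → Disjoint I.toSet J.toSet
  liesOn : ∀ I ∈ L, ∃ J ∈ P, LiesOn (leafOf I) J

/-- `P` is a non-leaf gap of `L`. -/
def IsNonLeafGap (L : Set Arc) (P : Set Arc) : Prop :=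
  IsGap L P ∧ ¬ IsLeaf L P

/-- The vertex set `S¹ ∖ ⋃ P` of a gap `P`. -/
def vertexSet (P : Set Arc) : Set Circle :=
  (⋃ I ∈ P, I.toSet)ᶜ

/-- `P` is an ideal polygon of `L`: a gap with finitely many vertices. -/
def IsIdealPolygon (L : Set Arc) (P : Set Arc) : Prop :=
  IsGap L P ∧ (vertexSet P).Finite

/-- `L` is very full: every gap is an ideal polygon. -/
def IsVeryFull (L : Set Arc) : Prop :=
  ∀ P, IsGap L P → IsIdealPolygon L P

/-- `{I, J}` is a distinct pair: `I` and `J` are disjoint and `{I, J}` is not a leaf. -/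
def IsDistinctPair (L : Set Arc) (I J : Arc) : Prop :=
  I ∈ L ∧ J ∈ L ∧ Disjoint I.toSet J.toSet ∧ ¬ IsLeaf L {I, J}

/-- The pair `{I, J}` is separated by a non-leaf gap (`K = K'` is allowed). -/
def IsSeparated (L : Set Arc) (I J : Arc) : Prop :=
  ∃ P, IsNonLeafGap L P ∧ ∃ K ∈ P, ∃ K' ∈ P, I.toSet ⊆ K.toSet ∧ J.toSet ⊆ K'.toSet

/-- `L` is totally disconnected: every distinct pair is separated. -/
def IsTotallyDisconnectedSystem (L : Set Arc) : Prop :=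
  ∀ I J, IsDistinctPair L I J → IsSeparated L I J

/-- A sequence `l` of leaves of `L` converges to the nondegenerate open interval `J`. -/
def ConvergesToArc (L : Set Arc) (l : ℕ → Set Arc) (J : Arc) : Prop :=
  ∃ I : ℕ → Arc, (∀ n, I n ∈ L ∧ l n = leafOf (I n)) ∧
    J.toSet ⊆ liminf (fun n => (I n).toSet) atTop ∧
    limsup (fun n => (I n).toSet) atTop ⊆ closure J.toSet

/-- A sequence `l` of leaves of `L` converges to the leaf `k`. -/
def ConvergesToLeaf (L : Set Arc) (l : ℕ → Set Arc) (k : Set Arc) : Prop :=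
  ∃ I ∈ k, ConvergesToArc L l I

/-- `l` is an `I`-side sequence of leaves of `L`. -/
def IsSideSequence (L : Set Arc) (I : Arc) (l : ℕ → Set Arc) : Prop :=
  (∀ n, IsLeaf L (l n) ∧ I ∉ l n ∧ LiesOn (l n) I) ∧ ConvergesToArc L l I

/-- `I` is isolated in `L`: there is no `I`-side sequence. -/
def IsIsolatedArc (L : Set Arc) (I : Arc) : Prop :=
  ¬ ∃ l : ℕ → Set Arc, IsSideSequence L I l

/-- A leaf is isolated if each of its elements is isolated. -/
def IsIsolatedLeaf (L : Set Arc) (l : Set Arc) : Prop :=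
  ∀ I ∈ l, IsIsolatedArc L I

/-! ### Groups acting on lamination systems -/

/-- `L` is `G`-invariant. -/
def IsInvariantSystem (L : Set Arc) (G : Subgroup HomeoPlus) : Prop :=
  ∀ g ∈ G, ∀ I ∈ L, I.map g ∈ L

/-- The action of `G` on `L` is minimal: the orbit of every leaf accumulates at every leaf. -/
def IsMinimalAction (L : Set Arc) (G : Subgroup HomeoPlus) : Prop :=
  ∀ l k, IsLeaf L l → IsLeaf L k →
    ∃ g : ℕ → HomeoPlus, (∀ n, g n ∈ G) ∧ ConvergesToLeaf L (fun n => Arc.map (g n) '' k) l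

/-- The non-leaf gaps of `L` form finitely many orbits under the action of `G`. -/
def HasFinitelyManyGapOrbits (L : Set Arc) (G : Subgroup HomeoPlus) : Prop :=
  ∃ S : Set (Set Arc), S.Finite ∧ (∀ P ∈ S, IsNonLeafGap L P) ∧
    ∀ P, IsNonLeafGap L P → ∃ Q ∈ S, ∃ g ∈ G, P = Arc.map g '' Q

/-- `(L, G)` is a tight pair. -/
structure IsTightPair (L : Set Arc) (G : Subgroup HomeoPlus) : Prop where
  lamination : IsLaminationSystem L
  invariant : IsInvariantSystem L G
  veryFull : IsVeryFull L
  totallyDisconnected : IsTotallyDisconnectedSystem L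
  not_isolated : ∀ I ∈ L, ¬ IsIsolatedLeaf L (leafOf I)
  minimal : IsMinimalAction L G
  finite_gap_orbits : HasFinitelyManyGapOrbits L G

/-- The point `x` is a global fixed point of `G`. -/
def IsGlobalFixedPoint (G : Subgroup HomeoPlus) (x : Circle) : Prop :=
  ∀ g ∈ G, g.1 x = x

/-! The proof is a ping-pong argument on leaves. Fix a non-leaf gap `P` and a side `J` of it.
Suppose four pairwise disjoint arcs are found, two containing translates `aJ`, `bJ` and two
containing translates `cJ*`, `dJ*`. Then `ca⁻¹` maps the dual of `aJ` onto `cJ*`, and `db⁻¹` maps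
the dual of `bJ` onto `dJ*`, so these two elements generate a free group of rank two
(`hasFreeSubgroup_of_hasTranslate`).

Minimality and the absence of isolated leaves move every leaf into every arc of the system
(`exists_translate_lt`), but do not control which of `J`, `J*` ends up inside. The orientation is
controlled by a dichotomy: either two sides of `P` contain translates of `J*` and two contain
translates of `J`, or `G` fixes a point. In the first case `P` can be moved so that all its sides
but one lie in a prescribed arc, which therefore contains disjoint translates of both kinds; doing
this in two sides of `P` yields the four arcs.

In the second case some side `M` is the only side of `P` containing a translate of `M`. Then for
each arc `Y` of the system exactly one of `Y`, `Y*` strictly contains a translate of `M`, which is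
an invariant choice of a side for each leaf. The arcs not chosen form a laminar family without
maximal elements, closed under increasing unions. A maximal chain of them fills the circle except
for one point, and that point is fixed by `G` (`exists_isGlobalFixedPoint_of_laminar`). -/

/-! ### Cutting the circle open -/

/-- Cutting the circle at `c` turns the circular order into a linear order. -/
theorem exists_cut (c : Circle) : ∃ φ : Circle → ℝ, Function.Injective φ ∧ (∀ z, φ c ≤ φ z) ∧
    ∀ x y z, PosOriented x y z ↔ (φ x < φ y ∧ φ y < φ z) ∨ (φ y < φ z ∧ φ z < φ x) ∨
      (φ z < φ x ∧ φ x < φ y) := by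
  classical
  -- The exponential makes every value off `c` positive, so that the value `0` at `c` is the
  -- minimum.
  let φ : Circle → ℝ := fun z => if z = c then 0 else Real.exp (stereoCoord (c⁻¹ * z))
  have hc : φ c = 0 := if_pos rfl
  have hne : ∀ z, z ≠ c → φ z = Real.exp (stereoCoord (c⁻¹ * z)) := fun z hz => if_neg hz
  have hpos : ∀ z, z ≠ c → 0 < φ z := fun z hz => by rw [hne z hz]; exact Real.exp_pos _
  have key : ∀ y z, y ≠ c → z ≠ c → y ≠ z → (PosOriented c y z ↔ φ y < φ z) := by
    intro y z hy hz hyz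
    rw [hne y hy, hne z hz, Real.exp_lt_exp]
    exact ⟨fun h => h.2.2.2, fun h => ⟨hy.symm, hyz, hz.symm, h⟩⟩
  have inj : Function.Injective φ := by
    intro y z h
    by_contra hyz
    by_cases hy : y = c
    · have := hpos z (by rintro rfl; exact hyz hy)
      rw [hy, hc] at h
      linarith
    by_cases hz : z = c
    · have := hpos y hy
      rw [hz, hc] at h
      linarith
    rcases posOriented_total (Ne.symm hy) hyz (Ne.symm hz) with h' | h'
    · exact ((key y z hy hz hyz).1 h').ne h
    · exact ((key z y hz hy (Ne.symm hyz)).1 h').ne h.symm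
  have hmin : ∀ z, φ c ≤ φ z := by
    intro z
    by_cases hz : z = c
    · rw [hz]
    · rw [hc]; exact (hpos z hz).le
  have fwd : ∀ x y z, φ x < φ y → φ y < φ z → PosOriented x y z := by
    intro x y z hxy hyz
    have hy : y ≠ c := by rintro rfl; exact (hmin x).not_gt hxy
    have hz : z ≠ c := by rintro rfl; exact (hmin y).not_gt hyz
    have h2 := (key y z hy hz (by rintro rfl; exact lt_irrefl _ hyz)).2 hyz
    by_cases hx : x = c
    · rw [hx]; exact h2
    · have h1 := (key x y hx hy (by rintro rfl; exact lt_irrefl _ hxy)).2 hxy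
      exact (h2.rotate.trans h1.rotate.rotate).rotate.rotate
  refine ⟨φ, inj, hmin, fun x y z => ⟨fun h => ?_, ?_⟩⟩
  · have h1 := inj.ne h.1
    have h2 := inj.ne h.2.1
    have h3 := inj.ne h.2.2.1
    by_contra hcon
    have : (φ x < φ z ∧ φ z < φ y) ∨ (φ z < φ y ∧ φ y < φ x) ∨ (φ y < φ x ∧ φ x < φ z) := by
      grind
    rcases this with ⟨a, b⟩ | ⟨a, b⟩ | ⟨a, b⟩
    · exact h.asymm (fwd _ _ _ a b)
    · exact h.asymm (fwd _ _ _ a b).rotate.rotate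
    · exact h.asymm (fwd _ _ _ a b).rotate
  · rintro (⟨a, b⟩ | ⟨a, b⟩ | ⟨a, b⟩)
    · exact fwd _ _ _ a b
    · exact (fwd _ _ _ a b).rotate.rotate
    · exact (fwd _ _ _ a b).rotate

/-! ### Arcs ordered by inclusion -/

namespace Arc

instance : PartialOrder Arc := PartialOrder.lift Arc.toSet Arc.toSet_injective

theorem le_def {I J : Arc} : I ≤ J ↔ I.toSet ⊆ J.toSet := Iff.rfl

@[simp] theorem dual_dual (I : Arc) : I.dual.dual = I := rfl

theorem nonempty (I : Arc) : I.toSet.Nonempty := exists_posOriented I.ne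

theorem u_notMem (I : Arc) : I.u ∉ I.toSet := fun h => h.1 rfl

theorem disjoint_dual (I : Arc) : Disjoint I.toSet I.dual.toSet :=
  Set.disjoint_left.2 fun _ hp hq => hp.rotate.rotate.asymm hq

theorem mem_or_mem_dual (I : Arc) (p : Circle) :
    p ∈ I.toSet ∨ p ∈ I.dual.toSet ∨ p = I.u ∨ p = I.v := by
  by_cases hu : p = I.u
  · exact Or.inr (Or.inr (Or.inl hu))
  by_cases hv : p = I.v
  · exact Or.inr (Or.inr (Or.inr hv))
  rcases posOriented_total (Ne.symm hu) hv I.ne with h | h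
  · exact Or.inl h
  · exact Or.inr (Or.inl h.rotate)

/-- Only the endpoints of `J` need an argument. If one of them lay in the open arc `I`, then points
of `J` close to it would lie in `I` too. Cutting at `I.u` makes `I` an interval of a linear order,
where such a point is written down. -/
theorem le_dual_of_disjoint {I J : Arc} (h : Disjoint I.toSet J.toSet) : I ≤ J.dual := by
  intro p hp
  have hpJ : p ∉ J.toSet := fun h' => Set.disjoint_left.1 h hp h'
  obtain ⟨φ, inj, hmin, hφ⟩ := exists_cut I.u
  have hJ := inj.ne J.ne
  have hI : φ I.u < φ I.v := lt_of_le_of_ne (hmin _) (inj.ne I.ne)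
  have hmem : ∀ q, φ I.u < φ q → φ q < φ I.v → q ∉ J.toSet := fun q h1 h2 hq =>
    Set.disjoint_left.1 h ((hφ _ _ _).2 (Or.inl ⟨h1, h2⟩)) hq
  have hp' : φ I.u < φ p ∧ φ p < φ I.v := by
    have := (hφ _ _ _).1 hp
    grind
  have between : ∀ x y, φ x < φ y → ∃ q, φ x < φ q ∧ φ q < φ y := by
    intro x y hxy
    obtain ⟨ψ, inj', hmin', hψ⟩ := exists_cut x
    obtain ⟨q, hq⟩ := exists_posOriented (x := x) (y := y) (by rintro rfl; exact lt_irrefl _ hxy)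
    have := (hφ _ _ _).1 hq
    refine ⟨q, ?_⟩
    grind
  rcases J.mem_or_mem_dual p with h1 | h1 | h1 | h1
  · exact absurd h1 hpJ
  · exact h1
  · exfalso
    by_cases hv : φ p < φ J.v ∧ φ J.v < φ I.v
    · obtain ⟨q, hq1, hq2⟩ := between p J.v hv.1
      refine hmem q (by linarith) (by linarith) ((hφ _ _ _).2 ?_)
      rw [← h1]; grind
    · obtain ⟨q, hq1, hq2⟩ := between p I.v hp'.2
      refine hmem q (by linarith) (by linarith) ((hφ _ _ _).2 ?_)
      rw [← h1] at hJ ⊢; grind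
  · exfalso
    by_cases hv : φ I.u < φ J.u ∧ φ J.u < φ p
    · obtain ⟨q, hq1, hq2⟩ := between J.u p hv.2
      refine hmem q (by linarith) (by linarith) ((hφ _ _ _).2 ?_)
      rw [← h1]; grind
    · obtain ⟨q, hq1, hq2⟩ := between I.u p hp'.1
      have := hmin J.u
      refine hmem q (by linarith) (by linarith) ((hφ _ _ _).2 ?_)
      rw [← h1] at hJ ⊢; grind

theorem disjoint_iff_le_dual {I J : Arc} : Disjoint I.toSet J.toSet ↔ I ≤ J.dual :=
  ⟨le_dual_of_disjoint, fun h => (J.disjoint_dual.symm).mono_left h⟩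

theorem dual_le_dual {I J : Arc} (h : I ≤ J) : J.dual ≤ I.dual :=
  le_dual_of_disjoint (J.disjoint_dual.symm.mono_right h)

theorem dual_le_dual_iff {I J : Arc} : J.dual ≤ I.dual ↔ I ≤ J :=
  ⟨fun h => dual_le_dual h, dual_le_dual⟩

theorem le_dual_comm {I J : Arc} : I ≤ J.dual ↔ J ≤ I.dual :=
  ⟨fun h => dual_le_dual h, fun h => dual_le_dual h⟩

theorem dual_le_comm {I J : Arc} : I.dual ≤ J ↔ J.dual ≤ I :=
  ⟨fun h => dual_le_dual h, fun h => dual_le_dual h⟩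

theorem dual_lt_dual {I J : Arc} (h : I < J) : J.dual < I.dual :=
  lt_of_le_not_ge (dual_le_dual h.le) fun h' => h.not_ge (dual_le_dual_iff.1 h')

theorem not_le_of_le_dual {A B C : Arc} (h : C ≤ A) (h' : C ≤ B) : ¬ A ≤ B.dual := by
  intro h''
  obtain ⟨p, hp⟩ := C.nonempty
  exact Set.disjoint_left.1 (disjoint_iff_le_dual.2 h'') (h hp) (h' hp)

theorem exists_mem_inter_dual {K B : Arc} (h : K < B) : ∃ y, y ∈ B.toSet ∧ y ∈ K.dual.toSet := by
  by_contra hcon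
  have : Disjoint B.toSet K.dual.toSet :=
    Set.disjoint_left.2 fun y h1 h2 => hcon ⟨y, h1, h2⟩
  exact h.not_ge (le_dual_of_disjoint this)

theorem isOpen (I : Arc) : IsOpen I.toSet := by
  have : I.toSet = {p : Circle | 0 < ((p : ℂ).re - (I.u : ℂ).re) * ((I.v : ℂ).im - (I.u : ℂ).im)
        - ((p : ℂ).im - (I.u : ℂ).im) * ((I.v : ℂ).re - (I.u : ℂ).re)} := by
    ext p
    exact posOriented_iff _ _ _
  rw [this]
  have hc : Continuous fun p : Circle => (p : ℂ) := by fun_prop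
  have h1 := Complex.continuous_re.comp hc
  have h2 := Complex.continuous_im.comp hc
  exact isOpen_lt continuous_const
    (((h1.sub continuous_const).mul continuous_const).sub
      ((h2.sub continuous_const).mul continuous_const))

theorem notMem_closure {I : Arc} {p : Circle} (h : p ∈ I.dual.toSet) : p ∉ closure I.toSet :=
  fun h' => Set.disjoint_left.1 (I.disjoint_dual.closure_left I.dual.isOpen) h' h

/-! ### The action of homeomorphisms on arcs -/

@[simp] theorem map_one (I : Arc) : I.map 1 = I := rfl

theorem map_mul (g h : HomeoPlus) (I : Arc) : I.map (g * h) = (I.map h).map g := rfl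

theorem map_dual (g : HomeoPlus) (I : Arc) : I.dual.map g = (I.map g).dual := rfl

@[simp] theorem map_inv_map (g : HomeoPlus) (I : Arc) : (I.map g).map g⁻¹ = I := by
  rw [← map_mul, inv_mul_cancel, map_one]

@[simp] theorem map_map_inv (g : HomeoPlus) (I : Arc) : (I.map g⁻¹).map g = I := by
  rw [← map_mul, mul_inv_cancel, map_one]

theorem map_mono (g : HomeoPlus) {I J : Arc} (h : I ≤ J) : I.map g ≤ J.map g := by
  rw [le_def, toSet_map, toSet_map]
  exact Set.image_mono h

theorem map_le_map_iff (g : HomeoPlus) {I J : Arc} : I.map g ≤ J.map g ↔ I ≤ J :=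
  ⟨fun h => by simpa using map_mono g⁻¹ h, map_mono g⟩

theorem map_le_iff (g : HomeoPlus) {I J : Arc} : I.map g ≤ J ↔ I ≤ J.map g⁻¹ := by
  rw [← map_le_map_iff g⁻¹, map_inv_map]

theorem map_lt_map_iff (g : HomeoPlus) {I J : Arc} : I.map g < J.map g ↔ I < J := by
  rw [lt_iff_le_not_ge, lt_iff_le_not_ge, map_le_map_iff, map_le_map_iff]

theorem map_lt_iff (g : HomeoPlus) {I J : Arc} : I.map g < J ↔ I < J.map g⁻¹ := by
  rw [← map_lt_map_iff g⁻¹, map_inv_map]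

end Arc

/-! ### Nestedness and the ping-pong criterion -/

theorem IsLaminationSystem.nested {L : Set Arc} (hL : IsLaminationSystem L) {I J : Arc}
    (hI : I ∈ L) (hJ : J ∈ L) : I ≤ J ∨ I.dual ≤ J ∨ I ≤ J.dual ∨ J ≤ I := by
  rcases hL.unlinked I hI J hJ with ⟨K, hK, h⟩ | ⟨K, hK, h⟩ <;> rcases hK with rfl | rfl
  · exact Or.inl h
  · exact Or.inr (Or.inl h)
  · exact Or.inr (Or.inr (Or.inl h))
  · exact Or.inr (Or.inr (Or.inr (Arc.dual_le_dual_iff.1 h)))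

theorem IsLaminationSystem.nested_or_nested_dual {L : Set Arc} (hL : IsLaminationSystem L)
    {I J : Arc} (hI : I ∈ L) (hJ : J ∈ L) :
    (I ≤ J ∨ I.dual ≤ J) ∨ (I ≤ J.dual ∨ I.dual ≤ J.dual) := by
  rcases hL.nested hI hJ with h | h | h | h
  · exact Or.inl (Or.inl h)
  · exact Or.inl (Or.inr h)
  · exact Or.inr (Or.inl h)
  · exact Or.inr (Or.inr (Arc.dual_le_dual h))

/-- `A` contains a `G`-translate of `X`. -/
def HasTranslate (G : Subgroup HomeoPlus) (X A : Arc) : Prop :=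
  ∃ g ∈ G, X.map g ≤ A

theorem HasTranslate.mono {G : Subgroup HomeoPlus} {X A B : Arc} (h : HasTranslate G X A)
    (hAB : A ≤ B) : HasTranslate G X B :=
  let ⟨g, hg, h⟩ := h
  ⟨g, hg, h.trans hAB⟩

theorem HasTranslate.map {G : Subgroup HomeoPlus} {X A : Arc} (h : HasTranslate G X A)
    {f : HomeoPlus} (hf : f ∈ G) : HasTranslate G X (A.map f) :=
  let ⟨g, hg, h⟩ := h
  ⟨f * g, mul_mem hf hg, Arc.map_mono f h⟩

theorem HasTranslate.trans {G : Subgroup HomeoPlus} {X A B : Arc} (h : HasTranslate G X A)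
    (h' : HasTranslate G A B) : HasTranslate G X B :=
  let ⟨_, hg, h'⟩ := h'
  (h.map hg).mono h'

/-- `G` contains a non-abelian free subgroup. -/
def HasFreeSubgroup (G : Subgroup HomeoPlus) : Prop :=
  ∃ H : Subgroup HomeoPlus, H ≤ G ∧ IsFreeGroup H ∧ ∃ a ∈ H, ∃ b ∈ H, a * b ≠ b * a

theorem hasFreeSubgroup_of_injective {G : Subgroup HomeoPlus} (f : FreeGroup Bool →* G)
    (hf : Function.Injective f) : HasFreeSubgroup G := by
  have hinj : Function.Injective (G.subtype.comp f) := G.subtype_injective.comp hf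
  refine ⟨(G.subtype.comp f).range, ?_, IsFreeGroup.ofMulEquiv (MonoidHom.ofInjective hinj),
    _, ⟨FreeGroup.of true, rfl⟩, _, ⟨FreeGroup.of false, rfl⟩, ?_⟩
  · rintro _ ⟨w, rfl⟩
    exact (f w).2
  · rw [← map_mul, ← map_mul]
    exact hinj.ne (by decide)

/-- The action of `G` on an invariant family of arcs. -/
@[reducible] noncomputable def IsInvariantSystem.mulAction {L : Set Arc} {G : Subgroup HomeoPlus}
    (h : IsInvariantSystem L G) : MulAction G L where
  smul g I := ⟨I.1.map g.1, h g.1 g.2 I.1 I.2⟩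
  one_smul _ := rfl
  mul_smul _ _ _ := rfl

open scoped Pointwise in
/-- The ping-pong lemma for the action on the leaves. -/
theorem hasFreeSubgroup_of_ping_pong {L : Set Arc} {G : Subgroup HomeoPlus}
    (hL : IsLaminationSystem L) (hG : IsInvariantSystem L G) (a : Bool → G) (A B : Bool → Arc)
    (hA : ∀ i, A i ∈ L) (hB : ∀ i, B i ∈ L)
    (hAA : A true < (A false).dual) (hBB : B true < (B false).dual)
    (hAB : ∀ i j, A i < (B j).dual) (ha : ∀ i, (B i).dual.map (a i).1 ≤ A i) :
    HasFreeSubgroup G := by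
  let _ := hG.mulAction
  have hsmul : ∀ (g : G) (I : L), ((g • I : L) : Arc) = I.1.map g.1 := fun _ _ => rfl
  -- Ping-pong is played on arcs of `L`, not on points: unlinkedness sends everything outside `S C`
  -- into `S C.dual`, whereas the endpoints of `C` lie neither in `C` nor in its dual. The strict
  -- inclusion below is needed because the leaf of `C` lies on both `C` and `C.dual`.
  let S : Arc → Set L := fun C => {I | I.1 ≤ C ∨ I.1.dual ≤ C}
  have hS : ∀ C D, C < D.dual → Disjoint (S C) (S D) := by
    intro C D h
    refine Set.disjoint_left.2 fun I hC hD => ?_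
    rcases hC with hC | hC <;> rcases hD with hD | hD
    · exact Arc.not_le_of_le_dual hC hD h.le
    · exact h.not_ge ((Arc.dual_le_comm.1 hD).trans hC)
    · exact h.not_ge ((Arc.dual_le_dual hD).trans hC)
    · exact Arc.not_le_of_le_dual hC hD h.le
  have hmove : ∀ (g : G) (C D : Arc), C ∈ L → C.dual.map g.1 ≤ D → g • (S C)ᶜ ⊆ S D := by
    rintro g C D hCL hCD _ ⟨I, hI, rfl⟩
    have hI' : ¬ (I.1 ≤ C ∨ I.1.dual ≤ C) := hI
    rcases (hL.nested_or_nested_dual I.2 hCL).resolve_left hI' with h | h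
    · exact Or.inl ((Arc.map_mono g.1 h).trans hCD)
    · exact Or.inr ((Arc.map_mono g.1 h).trans hCD)
  have hflip : ∀ C D : Arc, C < D.dual → D < C.dual := fun C D h => Arc.dual_lt_dual h
  refine hasFreeSubgroup_of_injective (FreeGroup.lift a)
    (FreeGroup.injective_lift_of_ping_pong a (fun i => S (A i)) (fun i => S (B i))
      (fun i => ⟨⟨A i, hA i⟩, Or.inl le_rfl⟩) ?_ ?_ (fun i j => hS _ _ (hAB i j))
      (fun i => hmove _ _ _ (hB i) (ha i)) (fun i => hmove _ _ _ (hA i) ?_))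
  · rintro (_ | _) (_ | _) hij
    · exact absurd rfl hij
    · exact hS _ _ (hflip _ _ hAA)
    · exact hS _ _ hAA
    · exact absurd rfl hij
  · rintro (_ | _) (_ | _) hij
    · exact absurd rfl hij
    · exact hS _ _ (hflip _ _ hBB)
    · exact hS _ _ hBB
    · exact absurd rfl hij
  · have := Arc.dual_le_dual (ha i)
    rw [← Arc.map_dual, Arc.dual_dual, ← Arc.map_le_map_iff (a i).1⁻¹, Arc.map_inv_map] at this
    exact this

/-- The arcs shrink to the translates they contain. An element carrying `J.map a` to `J.map c` takes
the dual of the repelling arc `J.map a` to the attracting arc `J.dual.map c`. -/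
theorem hasFreeSubgroup_of_hasTranslate {L : Set Arc} {G : Subgroup HomeoPlus}
    (hL : IsLaminationSystem L) (hG : IsInvariantSystem L G) {J A B C D : Arc} (hJ : J ∈ L)
    (hA : HasTranslate G J A) (hB : HasTranslate G J B) (hC : HasTranslate G J.dual C)
    (hD : HasTranslate G J.dual D) (hAB : A ≤ B.dual) (hAC : A ≤ C.dual) (hAD : A ≤ D.dual)
    (hBC : B ≤ C.dual) (hBD : B ≤ D.dual) (hCD : C ≤ D.dual) : HasFreeSubgroup G := by
  obtain ⟨a, ha, ha'⟩ := hA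
  obtain ⟨b, hb, hb'⟩ := hB
  obtain ⟨c, hc, hc'⟩ := hC
  obtain ⟨d, hd, hd'⟩ := hD
  have dis : ∀ {X Y X' Y' : Arc}, X ≤ X' → Y ≤ Y' → X' ≤ Y'.dual → X ≤ Y.dual :=
    fun h1 h2 h => (h1.trans h).trans (Arc.dual_le_dual h2)
  -- Two disjoint arcs that both miss a third one cannot be dual to each other.
  have strict : ∀ {X Y Z : Arc}, X ≤ Y.dual → X ≤ Z.dual → Y ≤ Z.dual → X < Y.dual := by
    intro X Y Z h1 h2 h3
    refine lt_of_le_of_ne h1 fun h => ?_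
    exact Arc.not_le_of_le_dual le_rfl (Arc.le_dual_comm.1 h3) (h ▸ Arc.le_dual_comm.1 h2)
  have ab := dis ha' hb' hAB
  have ac := dis ha' hc' hAC
  have ad := dis ha' hd' hAD
  have bc := dis hb' hc' hBC
  have bd := dis hb' hd' hBD
  have cd := dis hc' hd' hCD
  have hJ' := hL.dual_mem J hJ
  refine hasFreeSubgroup_of_ping_pong hL hG
    (fun i => bif i then ⟨c * a⁻¹, mul_mem hc (inv_mem ha)⟩ else ⟨d * b⁻¹, mul_mem hd (inv_mem hb)⟩)
    (fun i => bif i then J.dual.map c else J.dual.map d)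
    (fun i => bif i then J.map a else J.map b) ?_ ?_ ?_ ?_ ?_ ?_
  · rintro (_ | _)
    exacts [hG d hd _ hJ', hG c hc _ hJ']
  · rintro (_ | _)
    exacts [hG b hb _ hJ, hG a ha _ hJ]
  · exact strict cd (Arc.le_dual_comm.1 ac) (Arc.le_dual_comm.1 ad)
  · exact strict ab ac bc
  · have s1 := strict ac ad cd
    have s2 := strict bc bd cd
    have s3 := strict ad ac (Arc.le_dual_comm.1 cd)
    have s4 := strict bd bc (Arc.le_dual_comm.1 cd)
    rintro (_ | _) (_ | _)
    exacts [Arc.dual_lt_dual s4, Arc.dual_lt_dual s3, Arc.dual_lt_dual s2, Arc.dual_lt_dual s1]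
  · rintro (_ | _)
    · change (J.map b).dual.map (d * b⁻¹) ≤ _
      rw [Arc.map_mul, Arc.map_dual, Arc.map_inv_map]
      exact le_rfl
    · change (J.map a).dual.map (c * a⁻¹) ≤ _
      rw [Arc.map_mul, Arc.map_dual, Arc.map_inv_map]
      exact le_rfl

/-! ### Chains of leaves and minimality -/

theorem eventually_mem_of_subset_liminf {I : ℕ → Arc} {J : Arc}
    (h : J.toSet ⊆ liminf (fun n => (I n).toSet) atTop) {x : Circle} (hx : x ∈ J.toSet) :
    ∀ᶠ n in atTop, x ∈ (I n).toSet :=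
  mem_liminf_iff_eventually_mem.1 (h hx)

theorem eventually_notMem_of_limsup_subset {I : ℕ → Arc} {J : Arc}
    (h : limsup (fun n => (I n).toSet) atTop ⊆ closure J.toSet) {x : Circle}
    (hx : x ∈ J.dual.toSet) : ∀ᶠ n in atTop, x ∉ (I n).toSet := by
  have : x ∉ limsup (fun n => (I n).toSet) atTop := fun h' => Arc.notMem_closure hx (h h')
  rw [mem_limsup_iff_frequently_mem, not_frequently] at this
  exact this

/-- A non-isolated arc of `L` is approximated from inside by arcs of `L`. -/
theorem exists_mem_lt_of_not_isolated {L : Set Arc} {I : Arc}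
    (hI : ¬ IsIsolatedArc L I) {x y : Circle} (hx : x ∈ I.toSet) (hy : y ∈ I.toSet) :
    ∃ B ∈ L, B < I ∧ x ∈ B.toSet ∧ y ∈ B.toSet := by
  obtain ⟨l, hl, A, hA, h1, h2⟩ := not_not.1 hI
  obtain ⟨z, hz⟩ := I.dual.nonempty
  obtain ⟨n, ⟨hxn, hyn⟩, hzn⟩ := (((eventually_mem_of_subset_liminf h1 hx).and
    (eventually_mem_of_subset_liminf h1 hy)).and (eventually_notMem_of_limsup_subset h2 hz)).exists
  obtain ⟨hAn, hln⟩ := hA n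
  obtain ⟨-, hIn, K, hK, hKI⟩ := hl n
  rw [hln] at hIn hK
  refine ⟨A n, hAn, lt_of_le_of_ne ?_ ?_, hxn, hyn⟩
  · rcases hK with rfl | rfl
    · exact hKI
    · exact absurd (Arc.dual_le_comm.1 (Arc.le_def.2 hKI) hz) hzn
  · intro h
    exact hIn (Or.inl h.symm)

/-- An approximating arc that contains a point of `A` and a point of `I` outside `A` can only be
nested strictly between the two. -/
theorem exists_between_of_not_isolated {L : Set Arc} (hL : IsLaminationSystem L) {I : Arc}
    (hI : ¬ IsIsolatedArc L I) {A : Arc} (hA : A ∈ L) (hAI : A < I) :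
    ∃ B ∈ L, A < B ∧ B < I := by
  obtain ⟨x, hx, hxA⟩ := Set.not_subset.1 (fun h => hAI.not_ge (Arc.le_def.2 h))
  obtain ⟨a, ha⟩ := A.nonempty
  obtain ⟨B, hB, hBI, hxB, haB⟩ := exists_mem_lt_of_not_isolated hI hx (hAI.le ha)
  refine ⟨B, hB, lt_of_le_of_ne ?_ (by rintro rfl; exact hxA hxB), hBI⟩
  rcases hL.nested hB hA with h | h | h | h
  · exact absurd (h hxB) hxA
  · have h1 : I.dual ≤ I := (Arc.dual_le_dual hBI.le).trans (h.trans hAI.le)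
    exact absurd h1 (fun h1 => Arc.not_le_of_le_dual h1 le_rfl le_rfl)
  · exact absurd ha (fun ha => Set.disjoint_left.1 (Arc.disjoint_iff_le_dual.2 h) haB ha)
  · exact h

theorem exists_chain {L : Set Arc} {G : Subgroup HomeoPlus} (h : IsTightPair L G) :
    ∃ C₀ ∈ L, ∃ C₁ ∈ L, ∃ C₂ ∈ L, ∃ C₃ ∈ L, ∃ C₄ ∈ L, C₀ < C₁ ∧ C₁ < C₂ ∧ C₂ < C₃ ∧ C₃ < C₄ := by
  obtain ⟨I, hI⟩ := h.lamination.nonempty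
  have hiso := h.not_isolated I hI
  unfold IsIsolatedLeaf at hiso
  push Not at hiso
  obtain ⟨K, -, hK⟩ := hiso
  obtain ⟨x, hx⟩ := K.nonempty
  obtain ⟨A, hA, hAK, -⟩ := exists_mem_lt_of_not_isolated hK hx hx
  obtain ⟨B, hB, hAB, hBK⟩ := exists_between_of_not_isolated h.lamination hK hA hAK
  obtain ⟨C, hC, hBC, hCK⟩ := exists_between_of_not_isolated h.lamination hK hB hBK
  obtain ⟨D, hD, hCD, hDK⟩ := exists_between_of_not_isolated h.lamination hK hC hCK
  obtain ⟨E, hE, hDE, -⟩ := exists_between_of_not_isolated h.lamination hK hD hDK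
  exact ⟨A, hA, B, hB, C, hC, D, hD, E, hE, hAB, hBC, hCD, hDE⟩

/-- Four test points suffice: one in `A`, one in `K` outside `A`, one in `B` and `K.dual`, one in
`B.dual`. Late arcs contain the first two and miss the last two, and nestedness then leaves one
position. -/
theorem IsLaminationSystem.between {L : Set Arc} (hL : IsLaminationSystem L) {A K B : Arc}
    (hA : A ∈ L) (hB : B ∈ L) (hAK : A < K) (hKB : K < B) {I : ℕ → Arc} (hI : ∀ n, I n ∈ L)
    (h1 : K.toSet ⊆ liminf (fun n => (I n).toSet) atTop)
    (h2 : limsup (fun n => (I n).toSet) atTop ⊆ closure K.toSet) :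
    ∃ n, A < I n ∧ I n < B := by
  obtain ⟨x, hx, hxA⟩ := Set.not_subset.1 (fun h => hAK.not_ge (Arc.le_def.2 h))
  obtain ⟨a, ha⟩ := A.nonempty
  obtain ⟨y, hyB, hyK⟩ := Arc.exists_mem_inter_dual hKB
  obtain ⟨z, hz⟩ := B.dual.nonempty
  obtain ⟨n, ⟨hxn, han⟩, hyn, hzn⟩ := (((eventually_mem_of_subset_liminf h1 hx).and
    (eventually_mem_of_subset_liminf h1 (hAK.le ha))).and
    ((eventually_notMem_of_limsup_subset h2 hyK).and
    (eventually_notMem_of_limsup_subset h2 (Arc.dual_le_dual hKB.le hz)))).exists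
  have hAB : A ≤ B := hAK.le.trans hKB.le
  refine ⟨n, lt_of_le_of_ne ?_ ?_, lt_of_le_of_ne ?_ ?_⟩
  · rcases hL.nested (hI n) hA with h | h | h | h
    · exact absurd (h hxn) hxA
    · exact absurd (Arc.dual_le_comm.1 h (Arc.dual_le_dual hAB hz)) hzn
    · exact absurd ha (fun ha => Set.disjoint_left.1 (Arc.disjoint_iff_le_dual.2 h) han ha)
    · exact h
  · intro h
    exact hxA (h ▸ hxn)
  · rcases hL.nested (hI n) hB with h | h | h | h
    · exact h
    · exact absurd (Arc.dual_le_comm.1 h hz) hzn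
    · exact absurd (hAB ha) (fun ha => Set.disjoint_left.1 (Arc.disjoint_iff_le_dual.2 h) han ha)
    · exact absurd (h hyB) hyn
  · intro h
    exact hyn (h ▸ hyB)

theorem exists_translate_between {L : Set Arc} {G : Subgroup HomeoPlus} (h : IsTightPair L G)
    {A K B J : Arc} (hA : A ∈ L) (hK : K ∈ L) (hB : B ∈ L) (hJ : J ∈ L) (hAK : A < K)
    (hKB : K < B) : ∃ g ∈ G, (A < J.map g ∧ J.map g < B) ∨ (A < J.dual.map g ∧ J.dual.map g < B) := by
  have hL := h.lamination
  obtain ⟨g, hg, I, hI, C, hC, h1, h2⟩ := h.minimal _ _ ⟨K, hK, rfl⟩ ⟨J, hJ, rfl⟩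
  have hC' : ∀ n, C n = J.map (g n) ∨ C n = J.dual.map (g n) := by
    intro n
    have hn : Arc.map (g n) '' leafOf J = leafOf (C n) := (hC n).2
    obtain ⟨X, hX, hX'⟩ : C n ∈ Arc.map (g n) '' leafOf J := by
      rw [hn]
      exact Or.inl rfl
    rcases hX with rfl | rfl
    exacts [Or.inl hX'.symm, Or.inr hX'.symm]
  rcases hI with rfl | rfl
  · obtain ⟨n, hn⟩ := hL.between hA hB hAK hKB (fun n => (hC n).1) h1 h2
    refine ⟨g n, hg n, ?_⟩
    rcases hC' n with h' | h' <;> rw [h'] at hn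
    exacts [Or.inl hn, Or.inr hn]
  -- The leaves may converge to `K.dual` instead; the argument then runs between `B.dual` and
  -- `A.dual`.
  · obtain ⟨n, hn1, hn2⟩ := hL.between (hL.dual_mem _ hB) (hL.dual_mem _ hA) (Arc.dual_lt_dual hKB)
      (Arc.dual_lt_dual hAK) (fun n => (hC n).1) h1 h2
    have hn1' := Arc.dual_lt_dual hn1
    have hn2' := Arc.dual_lt_dual hn2
    refine ⟨g n, hg n, ?_⟩
    rcases hC' n with h' | h' <;> rw [h', ← Arc.map_dual] at hn1' hn2'
    exacts [Or.inr ⟨hn2', hn1'⟩, Or.inl ⟨hn2', hn1'⟩]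

/-- If `A` were minimal, so would be all its translates. Moving its leaf into two consecutive
windows of a chain must then put translates of `A.dual` there. These are strictly nested, and
dualizing gives two strictly nested translates of `A`. -/
theorem exists_mem_lt {L : Set Arc} {G : Subgroup HomeoPlus} (h : IsTightPair L G) {A : Arc}
    (hA : A ∈ L) : ∃ B ∈ L, B < A := by
  by_contra hmin
  obtain ⟨C₀, h₀, C₁, h₁, C₂, h₂, C₃, h₃, C₄, h₄, h01, h12, h23, h34⟩ := exists_chain h
  have key : ∀ g ∈ G, ∀ B ∈ L, ¬ B < A.map g := by
    intro g hg B hB hlt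
    refine hmin ⟨B.map g⁻¹, h.invariant _ (inv_mem hg) _ hB, ?_⟩
    rw [Arc.map_lt_iff, inv_inv]
    exact hlt
  obtain ⟨g, hg, hg'⟩ := exists_translate_between h h₀ h₁ h₂ hA h01 h12
  obtain ⟨f, hf, hf'⟩ := exists_translate_between h h₂ h₃ h₄ hA h23 h34
  have h1 := hg'.resolve_left fun h' => key g hg _ h₀ h'.1
  have h2 := hf'.resolve_left fun h' => key f hf _ h₂ h'.1
  exact key g hg _ (h.invariant f hf _ hA) (Arc.dual_lt_dual (h1.2.trans h2.1))

/-- Every leaf can be moved into every arc of `L`. -/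
theorem exists_translate_lt {L : Set Arc} {G : Subgroup HomeoPlus} (h : IsTightPair L G)
    {A J : Arc} (hA : A ∈ L) (hJ : J ∈ L) : ∃ g ∈ G, J.map g < A ∨ J.dual.map g < A := by
  obtain ⟨B, hB, hBA⟩ := exists_mem_lt h hA
  obtain ⟨C, hC, hCB⟩ := exists_mem_lt h hB
  obtain ⟨g, hg, hg'⟩ := exists_translate_between h hC hB hA hJ hCB hBA
  exact ⟨g, hg, hg'.imp And.right And.right⟩

theorem hasTranslate_or_dual {L : Set Arc} {G : Subgroup HomeoPlus} (h : IsTightPair L G)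
    {A J : Arc} (hA : A ∈ L) (hJ : J ∈ L) : HasTranslate G J A ∨ HasTranslate G J.dual A := by
  obtain ⟨g, hg, hg'⟩ := exists_translate_lt h hA hJ
  exact hg'.imp (fun h' => ⟨g, hg, h'.le⟩) (fun h' => ⟨g, hg, h'.le⟩)

/-! ### Gaps -/

/-- For `B < A` the arcs `B` and `A.dual` are disjoint without being dual, so total disconnectedness
applies. -/
theorem exists_nonLeafGap {L : Set Arc} {G : Subgroup HomeoPlus} (h : IsTightPair L G) :
    ∃ P, IsNonLeafGap L P := by
  obtain ⟨A, hA⟩ := h.lamination.nonempty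
  obtain ⟨B, hB, hBA⟩ := exists_mem_lt h hA
  have hleaf : ¬ IsLeaf L {B, A.dual} := by
    rintro ⟨X, -, hX⟩
    have hne : B ≠ A.dual := by
      rintro rfl
      exact Arc.not_le_of_le_dual hBA.le le_rfl le_rfl
    have h1 : B ∈ leafOf X := hX ▸ Or.inl rfl
    have h2 : A.dual ∈ leafOf X := hX ▸ Or.inr rfl
    have : A.dual = B.dual := by
      rcases h1 with rfl | rfl <;> rcases h2 with h2 | h2
      · exact absurd h2.symm hne
      · exact h2
      · exact h2
      · exact absurd h2.symm hne
    exact (Arc.dual_lt_dual hBA).ne this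
  obtain ⟨P, hP, -⟩ := h.totallyDisconnected B A.dual ⟨hB, h.lamination.dual_mem A hA,
    Arc.disjoint_iff_le_dual.2 hBA.le, hleaf⟩
  exact ⟨P, hP⟩

theorem IsGap.le_dual {L P : Set Arc} (hP : IsGap L P) {I J : Arc} (hI : I ∈ P) (hJ : J ∈ P)
    (hne : I ≠ J) : I ≤ J.dual :=
  Arc.disjoint_iff_le_dual.1 (hP.disjoint I hI J hJ hne)

theorem IsGap.nonempty {L P : Set Arc} (hL : L.Nonempty) (hP : IsGap L P) : P.Nonempty := by
  obtain ⟨I, hI⟩ := hL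
  obtain ⟨J, hJ, -⟩ := hP.liesOn I hI
  exact ⟨J, hJ⟩

/-- With at most two sides, not dual to each other, the gap would miss a nonempty open set, hence
infinitely many points, contrary to very fullness. -/
theorem IsNonLeafGap.exists_ne {L P : Set Arc} (hL : IsVeryFull L) (hP : IsNonLeafGap L P)
    {I J : Arc} (hI : I ∈ P) (hJ : J ∈ P) : ∃ K ∈ P, K ≠ I ∧ K ≠ J := by
  by_contra hcon
  push Not at hcon
  have hfin := (hL P hP.1).2
  have hopen : ∃ V : Set Circle, IsOpen V ∧ V.Nonempty ∧ V ⊆ I.dual.toSet ∧ V ⊆ J.dual.toSet := by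
    by_cases hIJ : J = I
    · exact ⟨I.dual.toSet, I.dual.isOpen, I.dual.nonempty, Subset.rfl, by rw [hIJ]⟩
    · have hlt : I < J.dual := by
        refine lt_of_le_of_ne (hP.1.le_dual hI hJ (Ne.symm hIJ)) fun h => hP.2 ⟨J, hP.1.subset hJ, ?_⟩
        ext K
        refine ⟨fun hK => ?_, ?_⟩
        · by_cases hKI : K = I
          · exact Or.inr (hKI.trans h)
          · exact Or.inl (hcon K hK hKI)
        · rintro (rfl | rfl)
          exacts [hJ, h ▸ hI]
      obtain ⟨y, hy, hy'⟩ := Arc.exists_mem_inter_dual hlt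
      exact ⟨J.dual.toSet ∩ I.dual.toSet, J.dual.isOpen.inter I.dual.isOpen, ⟨y, hy, hy'⟩,
        inter_subset_right, inter_subset_left⟩
  obtain ⟨V, hV, ⟨y, hy⟩, hVI, hVJ⟩ := hopen
  have : Nontrivial Circle := ⟨_, _, I.ne⟩
  refine (infinite_of_mem_nhds y (hV.mem_nhds hy)) (hfin.subset fun z hz hz' => ?_)
  obtain ⟨K, hK, hzK⟩ := mem_iUnion₂.1 hz'
  by_cases hKI : K = I
  · exact Set.disjoint_left.1 I.disjoint_dual (hKI ▸ hzK) (hVI hz)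
  · exact Set.disjoint_left.1 J.disjoint_dual (hcon K hK hKI ▸ hzK) (hVJ hz)

/-- A gap with at least three sides has a translate in every arc of `L`, up to one side. -/
theorem IsNonLeafGap.exists_dual_map_le {L P : Set Arc} {G : Subgroup HomeoPlus}
    (h : IsTightPair L G) (hP : IsNonLeafGap L P) {A : Arc} (hA : A ∈ L) :
    ∃ g ∈ G, ∃ K ∈ P, K.dual.map g ≤ A := by
  obtain ⟨K, hK⟩ := hP.1.nonempty h.lamination.nonempty
  obtain ⟨g, hg, hlt | hlt⟩ := exists_translate_lt h hA (hP.1.subset hK)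
  · rw [Arc.map_lt_iff] at hlt
    obtain ⟨M, hM, X, hX, hXM⟩ := hP.1.liesOn _ (h.invariant _ (inv_mem hg) _ hA)
    refine ⟨g, hg, M, hM, ?_⟩
    rw [Arc.map_le_iff]
    rcases hX with rfl | rfl
    · have hXM' : A.map g⁻¹ ≤ M := hXM
      have hKM := hlt.trans_le hXM'
      exact absurd (hP.1.le_dual hK hM hKM.ne) (Arc.not_le_of_le_dual le_rfl hKM.le)
    · exact Arc.dual_le_comm.1 hXM
  · exact ⟨g, hg, K, hK, hlt.le⟩

/-! ### Laminar families of arcs -/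

/-- An open union of arcs through a common point that misses two points is an arc. -/
theorem Arc.exists_toSet_eq {S : Set Arc} {a p q : Circle} (hS : S.Nonempty)
    (ha : ∀ I ∈ S, a ∈ I.toSet) (hpq : p ≠ q) (hp : ∀ I ∈ S, p ∉ I.toSet)
    (hq : ∀ I ∈ S, q ∉ I.toSet) : ∃ J : Arc, J.toSet = ⋃ I ∈ S, I.toSet := by
  set U : Set Circle := ⋃ I ∈ S, I.toSet with hU
  have memU : ∀ z, z ∈ U ↔ ∃ I ∈ S, z ∈ I.toSet := fun z => by simp [hU]
  have hopen : IsOpen U := isOpen_biUnion fun I _ => I.isOpen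
  have haU : a ∈ U := by
    obtain ⟨I, hI⟩ := hS
    exact (memU a).2 ⟨I, hI, ha I hI⟩
  have hpU : p ∈ Uᶜ := fun h => by
    obtain ⟨I, hI, h⟩ := (memU p).1 h
    exact hp I hI h
  have hqU : q ∈ Uᶜ := fun h => by
    obtain ⟨I, hI, h⟩ := (memU q).1 h
    exact hq I hI h
  have hcomp : IsCompact Uᶜ := hopen.isClosed_compl.isCompact
  have hcont : ContinuousOn (fun z => stereoCoord (a⁻¹ * z)) Uᶜ := by
    unfold stereoCoord
    refine ContinuousOn.div (by fun_prop) (by fun_prop) ?_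
    intro z hz h0
    have hn : Complex.normSq ((a⁻¹ * z : Circle) : ℂ) = 1 := Circle.normSq_coe _
    rw [Complex.normSq_apply] at hn
    have hre : ((a⁻¹ * z : Circle) : ℂ).re = 1 := by linarith
    have him : ((a⁻¹ * z : Circle) : ℂ).im = 0 := by
      rw [hre] at hn
      nlinarith
    have h1 : a⁻¹ * z = 1 := Circle.ext (Complex.ext
      (by rw [hre, Circle.coe_one, Complex.one_re]) (by rw [him, Circle.coe_one, Complex.one_im]))
    exact hz ((inv_mul_eq_one.1 h1) ▸ haU)
  -- Going counterclockwise from `a`, the points `v` and `u` are the first and the last outside the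
  -- union, which is therefore the arc from `u` through `a` to `v`.
  obtain ⟨v, hv, hvmin⟩ := hcomp.exists_isMinOn ⟨p, hpU⟩ hcont
  obtain ⟨u, hu, humax⟩ := hcomp.exists_isMaxOn ⟨p, hpU⟩ hcont
  have hne : ∀ z ∈ Uᶜ, a ≠ z := fun z hz h => hz (h ▸ haU)
  have hvz : ∀ z ∈ Uᶜ, ¬ PosOriented a z v := fun z hz h => (hvmin hz).not_gt h.2.2.2
  have huz : ∀ z ∈ Uᶜ, ¬ PosOriented a u z := fun z hz h => (humax hz).not_gt h.2.2.2
  have huv : u ≠ v := by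
    rintro rfl
    have hz : ∀ z ∈ Uᶜ, z = u := by
      intro z hz
      by_contra hzu
      rcases posOriented_total (hne z hz) hzu (hne u hu) with h | h
      · exact hvz z hz h
      · exact huz z hz h
    exact hpq ((hz p hpU).trans (hz q hqU).symm)
  refine ⟨⟨u, v, huv⟩, Set.Subset.antisymm ?_ ?_⟩
  · intro z hz
    by_contra hzU
    have hz' : PosOriented u z v := hz
    have h1 := hvz z hzU
    have h2 := huz z hzU
    have h3 := hne z hzU
    have h4 := hvz u hu
    have h5 := hne u hu
    have h6 := hne v hv
    obtain ⟨φ, inj, hmin, hφ⟩ := exists_cut a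
    have := inj.ne h3
    have := inj.ne h5
    have := inj.ne h6
    have := inj.ne huv
    have := hmin z
    have := hmin u
    have := hmin v
    rw [hφ] at h1 h2 h4 hz'
    grind
  · intro z hz
    obtain ⟨I, hI, hzI⟩ := (memU z).1 hz
    have haI := ha I hI
    have huI : u ∉ I.toSet := fun h => hu ((memU u).2 ⟨I, hI, h⟩)
    have hvI : v ∉ I.toSet := fun h => hv ((memU v).2 ⟨I, hI, h⟩)
    have h4 := hvz u hu
    change PosOriented u z v
    have huv' : PosOriented a v u :=
      (posOriented_total (hne u hu) huv (hne v hv)).resolve_left h4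
    obtain ⟨φ, inj, hmin, hφ⟩ := exists_cut I.u
    have mem : ∀ w, w ∈ I.toSet ↔ φ I.u < φ w ∧ φ w < φ I.v := by
      intro w
      have := hmin w
      have := hmin I.v
      have : w ∈ I.toSet ↔ _ := hφ I.u w I.v
      grind
    rw [mem] at haI hzI huI hvI
    have := hmin u
    have := hmin v
    have := inj.ne huv
    rw [hφ] at huv' ⊢
    grind

/-- Second countability reduces the union to a countable subfamily, and successive upper bounds in
the chain make it monotone. Closure of `L` under unions of sequences thereby applies to arbitrary
chains. -/
theorem exists_monotone_cofinal {R : Set Arc} (hR : R.Nonempty)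
    (hchain : ∀ Y ∈ R, ∀ Z ∈ R, Y ≤ Z ∨ Z ≤ Y) :
    ∃ A : ℕ → Arc, (∀ n, A n ∈ R) ∧ Monotone A ∧ ⋃ n, (A n).toSet = ⋃ I ∈ R, I.toSet := by
  obtain ⟨T, hTR, hT, hTU⟩ := TopologicalSpace.isOpen_biUnion_countable R Arc.toSet
    (fun I _ => I.isOpen)
  have hTne : T.Nonempty := by
    obtain ⟨Y, hY⟩ := hR
    obtain ⟨y, hy⟩ := Y.nonempty
    have : y ∈ ⋃ I ∈ T, I.toSet := hTU ▸ mem_biUnion hY hy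
    obtain ⟨I, hI, -⟩ := mem_iUnion₂.1 this
    exact ⟨I, hI⟩
  obtain ⟨f, rfl⟩ := hT.exists_eq_range hTne
  have hf : ∀ n, f n ∈ R := fun n => hTR ⟨n, rfl⟩
  have hdir : ∀ B C : R, ∃ D : R, B ≤ D ∧ C ≤ D := by
    intro B C
    rcases hchain B B.2 C C.2 with h | h
    exacts [⟨C, h, le_rfl⟩, ⟨B, le_rfl, h⟩]
  choose s hs using hdir
  let A : ℕ → R := fun n =>
    Nat.rec (motive := fun _ => R) ⟨f 0, hf 0⟩ (fun n B => s B ⟨f (n + 1), hf (n + 1)⟩) n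
  have hmono : Monotone A := monotone_nat_of_le_succ fun n => (hs _ _).1
  have hfA : ∀ n, f n ≤ A n := by
    rintro (_ | n)
    exacts [le_rfl, (hs (A n) ⟨f (n + 1), hf (n + 1)⟩).2]
  refine ⟨fun n => A n, fun n => (A n).2, hmono, Set.Subset.antisymm ?_ ?_⟩
  · exact iUnion_subset fun n => subset_biUnion_of_mem (u := Arc.toSet) (A n).2
  · rw [← hTU]
    refine iUnion₂_subset ?_
    rintro _ ⟨n, rfl⟩
    exact (Arc.le_def.1 (hfA n)).trans (subset_iUnion (fun n => (A n).1.toSet) n)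

/-- A group preserving a laminar family of arcs that is closed under increasing unions and has no
maximal element has a global fixed point. -/
theorem exists_isGlobalFixedPoint_of_laminar {G : Subgroup HomeoPlus} {R : Set Arc}
    (hne : R.Nonempty) (hinv : ∀ g ∈ G, ∀ Y ∈ R, Y.map g ∈ R)
    (hlam : ∀ Y ∈ R, ∀ Z ∈ R, Y ≤ Z ∨ Z ≤ Y ∨ Y ≤ Z.dual)
    (hunion : ∀ I : ℕ → Arc, (∀ n, I n ∈ R) → Monotone I →
      ∀ J : Arc, J.toSet = ⋃ n, (I n).toSet → J ∈ R)
    (hmax : ∀ Y ∈ R, ∃ Z ∈ R, Y < Z) : ∃ x, IsGlobalFixedPoint G x := by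
  obtain ⟨Y, hY⟩ := hne
  obtain ⟨a, ha⟩ := Y.nonempty
  let S : Set Arc := {Z | Z ∈ R ∧ Y ≤ Z}
  have hS : S.Nonempty := ⟨Y, hY, le_rfl⟩
  obtain ⟨A, hAS, hA, hAU⟩ := exists_monotone_cofinal hS fun Z hZ W hW => by
    rcases hlam Z hZ.1 W hW.1 with h | h | h
    · exact Or.inl h
    · exact Or.inr h
    · exact absurd h (Arc.not_le_of_le_dual hZ.2 hW.2)
  -- The chain misses at most one point: otherwise its union is an arc, which belongs to `R` and is
  -- maximal there.
  have hsub : ∀ p q, (∀ I ∈ S, p ∉ I.toSet) → (∀ I ∈ S, q ∉ I.toSet) → p = q := by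
    intro p q hp hq
    by_contra hpq
    obtain ⟨J, hJ⟩ := Arc.exists_toSet_eq hS (fun I hI => hI.2 ha) hpq hp hq
    have hJR : J ∈ R := hunion A (fun n => (hAS n).1) hA J (hJ.trans hAU.symm)
    obtain ⟨Z, hZ, hJZ⟩ := hmax J hJR
    have hYJ : Y ≤ J := by
      rw [Arc.le_def, hJ]
      exact subset_biUnion_of_mem (u := Arc.toSet) (show Y ∈ S from ⟨hY, le_rfl⟩)
    refine hJZ.not_ge ?_
    rw [Arc.le_def, hJ]
    exact subset_biUnion_of_mem (u := Arc.toSet) (show Z ∈ S from ⟨hZ, hYJ.trans hJZ.le⟩)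
  -- By compactness, a monotone sequence covering the circle would contain a term equal to the whole
  -- circle.
  obtain ⟨x, hx⟩ : ∃ x, x ∉ ⋃ n, (A n).toSet := by
    by_contra hcon
    push Not at hcon
    obtain ⟨n, hn⟩ := isCompact_univ.elim_directed_cover (fun n => (A n).toSet)
      (fun n => (A n).isOpen) (fun z _ => hcon z) (Monotone.directed_le (fun _ _ h => hA h))
    exact (A n).u_notMem (hn (mem_univ _))
  have hxS : ∀ I ∈ S, x ∉ I.toSet := fun I hI hxI =>
    hx (hAU ▸ subset_biUnion_of_mem (u := Arc.toSet) hI hxI)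
  -- An arc of `R` through `x` would meet the chain, since it has more than one point; laminarity
  -- then makes it comparable with a member, which is impossible.
  have hxR : ∀ Z ∈ R, x ∉ Z.toSet := by
    intro Z hZ hxZ
    obtain ⟨n, z, hz, hzZ⟩ : ∃ n, ∃ z, z ∈ (A n).toSet ∧ z ∈ Z.toSet := by
      by_contra hcon
      push Not at hcon
      have hnot : ∀ z ∈ Z.toSet, ∀ I ∈ S, z ∉ I.toSet := by
        intro z hz I hI hzI
        have : z ∈ ⋃ n, (A n).toSet := hAU ▸ subset_biUnion_of_mem (u := Arc.toSet) hI hzI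
        obtain ⟨n, hn⟩ := mem_iUnion.1 this
        exact hcon n z hn hz
      have : Nontrivial Circle := ⟨_, _, Z.ne⟩
      refine infinite_of_mem_nhds x (Z.isOpen.mem_nhds hxZ) ((finite_singleton x).subset ?_)
      exact fun z hz => hsub z x (hnot z hz) hxS
    rcases hlam _ (hAS n).1 Z hZ with h | h | h
    · exact hxS Z ⟨hZ, (hAS n).2.trans h⟩ hxZ
    · exact hxS _ (hAS n) (h hxZ)
    · exact Set.disjoint_left.1 (Arc.disjoint_iff_le_dual.2 h) hz hzZ
  refine ⟨x, fun g hg => hsub _ _ (fun I hI hgx => ?_) hxS⟩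
  have := hinv g⁻¹ (inv_mem hg) I hI.1
  refine hxR _ this ?_
  rw [Arc.toSet_map]
  exact ⟨_, hgx, g.1.symm_apply_apply x⟩

/-! ### The dichotomy -/

/-- If only one side `M` of a non-leaf gap contains translates of `M`, then there is a global
fixed point. -/
theorem IsNonLeafGap.exists_isGlobalFixedPoint {L P : Set Arc} {G : Subgroup HomeoPlus}
    (h : IsTightPair L G) (hP : IsNonLeafGap L P) {M : Arc} (hM : M ∈ P)
    (huniq : ∀ K ∈ P, HasTranslate G M K → K = M) : ∃ x, IsGlobalFixedPoint G x := by
  have hL := h.lamination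
  have hML := hP.1.subset hM
  let N : Arc → Prop := fun Y => ∃ g ∈ G, M.map g < Y
  have Nmono : ∀ {Y Z}, N Y → Y ≤ Z → N Z := fun ⟨g, hg, hlt⟩ h => ⟨g, hg, hlt.trans_le h⟩
  have Nmap : ∀ {Y g}, g ∈ G → N Y → N (Y.map g) := by
    rintro Y g hg ⟨f, hf, hlt⟩
    exact ⟨g * f, mul_mem hg hf, (Arc.map_lt_map_iff g).2 hlt⟩
  -- Otherwise some translate of `M` lies strictly inside `M.dual`. Its leaf lies on a side of `P`;
  -- that side would be `M` by uniqueness, or would strictly contain `M`, and both contradict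
  -- disjointness.
  have Nnot : ∀ {Y}, N Y → ¬ N Y.dual := by
    rintro Y ⟨g, hg, hgY⟩ ⟨f, hf, hfY⟩
    have hfL := h.invariant _ (mul_mem (inv_mem hg) hf) _ hML
    obtain ⟨K, hK, X, hX, hXK⟩ := hP.1.liesOn _ hfL
    have hfg : M.map f < (M.map g).dual := hfY.trans (Arc.dual_lt_dual hgY)
    have hfg' : M.map (g⁻¹ * f) < M.dual := by
      rw [Arc.map_mul, Arc.map_lt_iff, inv_inv]
      exact hfg
    rcases hX with rfl | rfl
    · have hXK' : M.map (g⁻¹ * f) ≤ K := hXK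
      obtain rfl := huniq K hK ⟨_, mul_mem (inv_mem hg) hf, hXK'⟩
      exact Arc.not_le_of_le_dual le_rfl hXK' hfg'.le
    · have hMK : M < K := (Arc.dual_lt_dual hfg').trans_le hXK
      exact Arc.not_le_of_le_dual le_rfl hMK.le (hP.1.le_dual hM hK hMK.ne)
  -- A side `K ≠ M` is disjoint from `M`, so moving the leaf of `Y` into `K` leaves `M` strictly
  -- inside the complementary arc.
  have Nor : ∀ {Y}, Y ∈ L → N Y ∨ N Y.dual := by
    intro Y hY
    obtain ⟨K, hK, hKM, -⟩ := hP.exists_ne h.veryFull hM hM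
    have hMK : M ≤ K.dual := hP.1.le_dual hM hK (Ne.symm hKM)
    obtain ⟨g, hg, hlt | hlt⟩ := exists_translate_lt h (hP.1.subset hK) hY
    · have := Nmap (inv_mem hg) ⟨1, one_mem G, hMK.trans_lt (Arc.dual_lt_dual hlt)⟩
      rw [← Arc.map_dual, Arc.map_inv_map] at this
      exact Or.inr this
    · have := Nmap (inv_mem hg) ⟨1, one_mem G, hMK.trans_lt (Arc.dual_lt_dual hlt)⟩
      rw [← Arc.map_dual, Arc.map_inv_map] at this
      exact Or.inl this
  refine exists_isGlobalFixedPoint_of_laminar (G := G) (R := {Y | Y ∈ L ∧ ¬ N Y}) ?_ ?_ ?_ ?_ ?_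
  · by_cases hN : N M
    · exact ⟨_, hL.dual_mem M hML, Nnot hN⟩
    · exact ⟨M, hML, hN⟩
  · rintro g hg Y ⟨hY, hN⟩
    refine ⟨h.invariant g hg Y hY, fun hN' => hN ?_⟩
    simpa using Nmap (inv_mem hg) hN'
  · rintro Y ⟨hY, hYN⟩ Z ⟨hZ, hZN⟩
    rcases hL.nested hY hZ with h' | h' | h' | h'
    · exact Or.inl h'
    · exact absurd (Nmono ((Nor hY).resolve_left hYN) h') hZN
    · exact Or.inr (Or.inr h')
    · exact Or.inr (Or.inl h')
  · intro I hI hmono J hJ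
    have hIJ : ∀ n, I n ≤ J := fun n => by
      rw [Arc.le_def, hJ]
      exact subset_iUnion (fun n => (I n).toSet) n
    refine ⟨hL.iUnion_mem I (fun n => (hI n).1) (fun n => hmono n.le_succ) J hJ, ?_⟩
    -- A late arc of the sequence contains a point of `M.map g` and a point outside it, so it
    -- already strictly contains `M.map g`.
    rintro ⟨g, hg, hlt⟩
    have hMg := h.invariant g hg M hML
    obtain ⟨z, hz⟩ := (M.map g).nonempty
    obtain ⟨w, hw, hwM⟩ := Set.not_subset.1 (fun h => hlt.not_ge (Arc.le_def.2 h))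
    rw [hJ] at hw
    obtain ⟨m, hm⟩ := mem_iUnion.1 hw
    obtain ⟨n, hn⟩ := mem_iUnion.1 (hJ ▸ hlt.le hz : z ∈ ⋃ n, (I n).toSet)
    have hmk := hmono (le_max_left m n) hm
    have hnk := hmono (le_max_right m n) hn
    rcases hL.nested hMg (hI (max m n)).1 with h' | h' | h' | h'
    · exact (hI _).2 ⟨g, hg, lt_of_le_of_ne h' fun he => hwM (he ▸ hmk)⟩
    · have := (Arc.dual_le_dual hlt.le).trans (h'.trans (hIJ _))
      exact Arc.not_le_of_le_dual this le_rfl le_rfl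
    · exact Set.disjoint_left.1 (Arc.disjoint_iff_le_dual.2 h') hz hnk
    · exact hwM (h' hmk)
  · rintro Y ⟨hY, hYN⟩
    obtain ⟨g, hg, hlt | hlt⟩ := exists_translate_lt h hY hY
    · refine ⟨Y.map g⁻¹, ⟨h.invariant _ (inv_mem hg) _ hY, fun hN => hYN ?_⟩,
        (Arc.map_lt_iff g).1 hlt⟩
      simpa using Nmap hg hN
    · exact absurd (Nmono (Nmap hg ((Nor hY).resolve_left hYN)) hlt.le) hYN

/-- If at most one side of a non-leaf gap contains translates of `J.dual`, then there is a global
fixed point. -/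
theorem IsNonLeafGap.exists_isGlobalFixedPoint_of_subsingleton {L P : Set Arc}
    {G : Subgroup HomeoPlus} (h : IsTightPair L G) (hP : IsNonLeafGap L P) {J : Arc} (hJ : J ∈ L)
    (huniq : ∀ K ∈ P, ∀ K' ∈ P, HasTranslate G J.dual K → HasTranslate G J.dual K' → K = K') :
    ∃ x, IsGlobalFixedPoint G x := by
  -- This `M` is a side containing a translate of `J.dual`; a side containing a translate of `M`
  -- then does so too, hence equals `M`.
  obtain ⟨g, hg, M, hM, hMJ⟩ := hP.exists_dual_map_le h hJ
  have hJM : HasTranslate G J.dual M := by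
    refine ⟨g⁻¹, inv_mem hg, ?_⟩
    rw [Arc.map_le_iff, inv_inv]
    exact Arc.dual_le_comm.1 hMJ
  exact hP.exists_isGlobalFixedPoint h hM fun K hK hMK => huniq K hK M hM (hJM.trans hMK) hJM

/-- If two sides of a gap contain translates of `J` and two sides contain translates of `J.dual`,
then every arc of `L` contains disjoint translates of `J` and `J.dual`. -/
theorem IsNonLeafGap.exists_disjoint_hasTranslate {L P : Set Arc} {G : Subgroup HomeoPlus}
    (h : IsTightPair L G) (hP : IsNonLeafGap L P) {J : Arc} (hJ : J ∈ L)
    {A₁ A₂ B₁ B₂ : Arc} (hA₁ : A₁ ∈ P) (hA₂ : A₂ ∈ P) (hB₁ : B₁ ∈ P) (hB₂ : B₂ ∈ P)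
    (hA : A₁ ≠ A₂) (hB : B₁ ≠ B₂) (hJA₁ : HasTranslate G J A₁) (hJA₂ : HasTranslate G J A₂)
    (hJB₁ : HasTranslate G J.dual B₁) (hJB₂ : HasTranslate G J.dual B₂) {C : Arc} (hC : C ∈ L) :
    ∃ X Y, X ≤ C ∧ Y ≤ C ∧ X ≤ Y.dual ∧ HasTranslate G J X ∧ HasTranslate G J.dual Y := by
  obtain ⟨g, hg, K, hK, hKC⟩ := hP.exists_dual_map_le h hC
  have key : ∀ X ∈ P, ∀ Y ∈ P, X ≠ Y → X ≠ K → Y ≠ K → HasTranslate G J X →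
      HasTranslate G J.dual Y →
      ∃ X Y, X ≤ C ∧ Y ≤ C ∧ X ≤ Y.dual ∧ HasTranslate G J X ∧ HasTranslate G J.dual Y :=
    fun X hX Y hY hXY hXK hYK h1 h2 => ⟨X.map g, Y.map g,
      (Arc.map_mono g (hP.1.le_dual hX hK hXK)).trans hKC,
      (Arc.map_mono g (hP.1.le_dual hY hK hYK)).trans hKC,
      Arc.map_mono g (hP.1.le_dual hX hY hXY), h1.map hg, h2.map hg⟩
  obtain ⟨X, hX, hXK, hJX⟩ : ∃ X ∈ P, X ≠ K ∧ HasTranslate G J X := by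
    by_cases hK : A₁ = K
    · exact ⟨A₂, hA₂, fun h => hA (hK.trans h.symm), hJA₂⟩
    · exact ⟨A₁, hA₁, hK, hJA₁⟩
  obtain ⟨Y, hY, hYK, hJY⟩ : ∃ X ∈ P, X ≠ K ∧ HasTranslate G J.dual X := by
    by_cases hK : B₁ = K
    · exact ⟨B₂, hB₂, fun h => hB (hK.trans h.symm), hJB₂⟩
    · exact ⟨B₁, hB₁, hK, hJB₁⟩
  -- If one side serves for both orientations, a third side takes over whichever orientation it
  -- contains.
  by_cases hXY : X = Y
  · obtain ⟨Z, hZ, hZK, hZX⟩ := hP.exists_ne h.veryFull hK hX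
    rcases hasTranslate_or_dual h (hP.1.subset hZ) hJ with hJZ | hJZ
    · exact key Z hZ Y hY (hXY ▸ hZX) hZK hYK hJZ hJY
    · exact key X hX Z hZ hZX.symm hXK hZK hJX hJZ
  · exact key X hX Y hY hXY hXK hYK hJX hJY

/-! ### Four disjoint translates and the free subgroup -/

theorem mainTheorem3 (L : Set Arc) (G : Subgroup HomeoPlus) (hLG : IsTightPair L G)
    (hG : ¬ ∃ x : Circle, IsGlobalFixedPoint G x) :
    ∃ H : Subgroup HomeoPlus, H ≤ G ∧ IsFreeGroup H ∧ ∃ a ∈ H, ∃ b ∈ H, a * b ≠ b * a := by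
  obtain ⟨P, hP⟩ := exists_nonLeafGap hLG
  obtain ⟨J, hJP⟩ := hP.1.nonempty hLG.lamination.nonempty
  have hJ := hP.1.subset hJP
  have hminus : ∃ K ∈ P, ∃ K' ∈ P, HasTranslate G J.dual K ∧ HasTranslate G J.dual K' ∧ K ≠ K' := by
    by_contra hcon
    push Not at hcon
    exact hG (hP.exists_isGlobalFixedPoint_of_subsingleton hLG hJ hcon)
  have hplus : ∃ K ∈ P, ∃ K' ∈ P, HasTranslate G J K ∧ HasTranslate G J K' ∧ K ≠ K' := by
    by_contra hcon
    push Not at hcon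
    exact hG (hP.exists_isGlobalFixedPoint_of_subsingleton hLG (hLG.lamination.dual_mem J hJ) hcon)
  obtain ⟨A₁, hA₁, A₂, hA₂, hJA₁, hJA₂, hA⟩ := hplus
  obtain ⟨B₁, hB₁, B₂, hB₂, hJB₁, hJB₂, hB⟩ := hminus
  have key := fun {C : Arc} (hC : C ∈ L) => hP.exists_disjoint_hasTranslate hLG hJ hA₁ hA₂ hB₁ hB₂
    hA hB hJA₁ hJA₂ hJB₁ hJB₂ hC
  obtain ⟨X₁, Y₁, hX₁, hY₁, hXY₁, hJX₁, hJY₁⟩ := key (hP.1.subset hA₁)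
  obtain ⟨X₂, Y₂, hX₂, hY₂, hXY₂, hJX₂, hJY₂⟩ := key (hP.1.subset hA₂)
  -- Pairs taken from different sides are disjoint because `A₁` and `A₂` are.
  have dis : ∀ {U V}, U ≤ A₁ → V ≤ A₂ → U ≤ V.dual := fun hU hV =>
    (hU.trans (hP.1.le_dual hA₁ hA₂ hA)).trans (Arc.dual_le_dual hV)
  exact hasFreeSubgroup_of_hasTranslate hLG.lamination hLG.invariant hJ hJX₁ hJX₂ hJY₁ hJY₂
    (dis hX₁ hX₂) hXY₁ (dis hX₁ hY₂) (Arc.le_dual_comm.1 (dis hY₁ hX₂)) hXY₂ (dis hY₁ hY₂)
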